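/- Let $d, m \in \mathbb{N}$ and let $\mathscr{U}$ be the set of all functions $\mathbb{Z}^d \to \mathbb{R}^m$. Let $\bar\zeta \in W^{1,\infty}(\mathbb{R}^d;\mathbb{R})$ (identified with its continuous representative) have compact support and satisfy $\bar\zeta(0)=1$, $\bar\zeta(\xi)=0$ for all $\xi\in\mathbb{Z}^d\setminus\{0\}$, and $\sum_{\xi\in\mathbb{Z}^d}\bar\zeta(x-\xi)(a+b\cdot\xi)=a+b\cdot x$ for all $a\in\mathbb{R}$ and $b,x\in\mathbb{R}^d$. For $u\in\mathscr{U}$ put $\bar u(x)=\sum_{\xi\in\mathbb{Z}^d}u(\xi)\,\bar\zeta(x-\xi)$, $\|u\|_{\mathscr{U}^{1,p}}=\|\nabla\bar u\|_{L^p(\mathbb{R}^d)}$ with $\nabla\bar u$ the weak gradient (measured pointwise in the operator norm), $[u]=\{u+t : t\in\mathbb{R}^m\}$, and $\mathscr{U}^{1,p}=\{[u] : u\in\mathscr{U},\ \|u\|_{\mathscr{U}^{1,p}}<\infty\}$. Let $p\in[1,\infty)$. (i) If $p>d$, there is a constant $C$, depending only on $d,m,\bar\zeta,p$, such that for every $u\in\mathscr{U}$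 with $[u]\in\mathscr{U}^{1,p}$ and every $\xi\in\mathbb{Z}^d$, $|u(\xi)-u(0)|\le C\,\|u\|_{\mathscr{U}^{1,p}}\,|\xi|^{1/p'}$, where $p'=p/(p-1)$. (ii) If $p=d$, there is a constant $C$, depending only on $d,m,\bar\zeta,p$, such that for every $u\in\mathscr{U}$ with $[u]\in\mathscr{U}^{1,p}$ and every $\xi\in\mathbb{Z}^d\setminus\{0\}$, $|u(\xi)-u(0)|\le C\,\|u\|_{\mathscr{U}^{1,p}}\,(1+\log|\xi|)$. (iii) If $p<d$, then for every $u\in\mathscr{U}$ with $[u]\in\mathscr{U}^{1,p}$ there exists $u_0\in[u]$ with $u_0\in\ell^{p^*}(\mathbb{Z}^d;\mathbb{R}^m)$, where $p^*=dp/(d-p)$. -/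

import Mathlib

open MeasureTheory
open scoped ENNReal ContDiff

noncomputable section

namespace LatticeInterpolation

/-- Euclidean space `ℝⁿ`. -/
abbrev Eucl (n : ℕ) : Type := EuclideanSpace ℝ (Fin n)

/-- The lattice `ℤᵈ`. -/
abbrev IntLattice (d : ℕ) : Type := Fin d → ℤ

/-- A lattice point, seen as a point of `ℝᵈ`. -/
def IntLattice.toEucl {d : ℕ} (ξ : IntLattice d) : Eucl d := WithLp.toLp 2 fun i => (ξ i : ℝ)

/-- The space `𝒰` of all lattice functions `ℤᵈ → ℝᵐ`. -/
abbrev LatticeFun (d m : ℕ) : Type := IntLattice d → Eucl m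

section Sobolev

variable {d : ℕ} {F : Type*} [NormedAddCommGroup F] [NormedSpace ℝ F]

/-- `G` is a weak gradient of `f : ℝᵈ → F`: both are locally integrable and
`∫ (∂ᵥ φ) f = - ∫ φ (G v)` for all test functions `φ ∈ C_c^∞(ℝᵈ)` and all directions `v`. -/
structure IsWeakGradient (f : Eucl d → F) (G : Eucl d → Eucl d →L[ℝ] F) : Prop where
  locallyIntegrable : LocallyIntegrable f volume
  locallyIntegrable_grad : LocallyIntegrable G volume
  integral_eq : ∀ φ : Eucl d → ℝ, ContDiff ℝ ∞ φ → HasCompactSupport φ → ∀ v : Eucl d,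
    ∫ x, (fderiv ℝ φ x v) • f x = - ∫ x, φ x • G x v

/-- `f ∈ W^{1,∞}(ℝᵈ; F)`: `f` is essentially bounded and so is its weak gradient. -/
def MemSobolevOneInfty (f : Eucl d → F) : Prop :=
  MemLp f ⊤ volume ∧ ∃ G : Eucl d → Eucl d →L[ℝ] F, IsWeakGradient f G ∧ MemLp G ⊤ volume

/-- `‖∇ f‖_{L^p(ℝᵈ)}` for the weak gradient `∇ f`. All weak gradients of `f` agree almost
everywhere, so the infimum runs over one number (see `gradNorm_eq`); it is `∞` if `f` has no weak
gradient. -/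
def gradNorm (f : Eucl d → F) (p : ℝ≥0∞) : ℝ≥0∞ :=
  ⨅ (G : Eucl d → Eucl d →L[ℝ] F) (_ : IsWeakGradient f G), eLpNorm G p volume

theorem IsWeakGradient.ae_eq [CompleteSpace F] {f : Eucl d → F} {G H : Eucl d → Eucl d →L[ℝ] F}
    (hG : IsWeakGradient f G) (hH : IsWeakGradient f H) : G =ᵐ[volume] H := by
  refine ae_eq_of_integral_contDiff_smul_eq hG.locallyIntegrable_grad hH.locallyIntegrable_grad ?_
  intro φ hφ hc
  have iG : Integrable (fun x => φ x • G x) volume :=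
    hG.locallyIntegrable_grad.integrable_smul_left_of_hasCompactSupport hφ.continuous hc
  have iH : Integrable (fun x => φ x • H x) volume :=
    hH.locallyIntegrable_grad.integrable_smul_left_of_hasCompactSupport hφ.continuous hc
  ext v
  rw [ContinuousLinearMap.integral_apply iG, ContinuousLinearMap.integral_apply iH]
  have h := (hG.integral_eq φ hφ hc v).symm.trans (hH.integral_eq φ hφ hc v)
  simpa using h

theorem gradNorm_eq [CompleteSpace F] {f : Eucl d → F} {G : Eucl d → Eucl d →L[ℝ] F}
    (hG : IsWeakGradient f G) (p : ℝ≥0∞) : gradNorm f p = eLpNorm G p volume :=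
  le_antisymm (iInf₂_le G hG)
    (le_iInf₂ fun _ hH => (eLpNorm_congr_ae (hG.ae_eq hH)).le)

end Sobolev

/-- The standing assumptions on the nodal basis function `ζ` associated with the origin.
`W^{1,∞}` functions are identified with their continuous representatives, so that point values
make sense. -/
structure IsNodalBasis {d : ℕ} (ζ : Eucl d → ℝ) : Prop where
  continuous : Continuous ζ
  regularity : MemSobolevOneInfty ζ
  locality : HasCompactSupport ζ
  order : ∀ (a : ℝ) (b x : Eucl d),
    ∑ᶠ ξ : IntLattice d, ζ (x - ξ.toEucl) * (a + inner ℝ b ξ.toEucl) = a + inner ℝ b x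
  zero_eq_one : ζ 0 = 1
  eq_zero : ∀ ξ : IntLattice d, ξ ≠ 0 → ζ ξ.toEucl = 0

variable {d m : ℕ}

/-- The interpolant `ū(x) = ∑_ξ u(ξ) ζ(x - ξ)`, a finite sum for each `x` if `ζ` has compact
support. -/
def interpolant (ζ : Eucl d → ℝ) (u : LatticeFun d m) (x : Eucl d) : Eucl m :=
  ∑ᶠ ξ : IntLattice d, ζ (x - ξ.toEucl) • u ξ

/-- The (semi-)norm `‖u‖_{𝒰^{1,p}} = ‖∇ū‖_{L^p}`, with values in `[0, ∞]`. -/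
def latticeSeminorm (ζ : Eucl d → ℝ) (p : ℝ≥0∞) (u : LatticeFun d m) : ℝ≥0∞ :=
  gradNorm (interpolant ζ u) p

/-- The equivalence class `[u] = {u + t | t ∈ ℝᵐ}` of a lattice function modulo constants. -/
def translationClass (u : LatticeFun d m) : Set (LatticeFun d m) :=
  {w | ∃ t : Eucl m, w = fun ξ => u ξ + t}

/-- The discrete homogeneous Sobolev space `𝒰^{1,p} = {[u] | u ∈ 𝒰, ‖∇ū‖_{L^p} < ∞}`. -/
def homogeneousSpace (ζ : Eucl d → ℝ) (m : ℕ) (p : ℝ≥0∞) : Set (Set (LatticeFun d m)) :=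
  {c | ∃ u : LatticeFun d m, c = translationClass u ∧ latticeSeminorm ζ p u < ⊤}

end LatticeInterpolation

end

open LatticeInterpolation

open scoped Convolution

namespace LatticeInterpolation

variable {d m : ℕ}

/-! Everything reduces to an `ℓ^p` bound on the coordinate differences of `u` by the `L^p` norm of
`∇ū`; the rest is analysis on `ℤᵈ`.

For this bound, the nodal property makes `u (ξ + e_i) - u ξ` a difference of two values of `ū`. On a
ball, `ū` is a combination of finitely many translates of `ζ`, and by duality in finite dimension
(`exists_testFunction_integral_fderiv_eq_sub`) taking this difference is the same as integrating
against `∂_i φ` for a single test function `φ`. Integration by parts, Hölder and the bounded overlap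
of balls give `IsNodalBasis.exists_tsum_enorm_sub_rpow_le`.

For `p > d`, Hölder along a coordinate path from `0` to `ξ` already yields the exponent `1/p'`. For
`p ≤ d`, averages over cubes of side `2^k` are compared: successive ones differ by at most a
constant times `2^(k(1 - d/p))`. If `p = d`, about `log |ξ|` bounded terms add up. If `p < d`, the
series is geometric and `u` has a limit `t` at infinity
(`DifferencesBoundedBy.exists_tendsto_cofinite`). The discrete Sobolev inequality, obtained for
finitely supported functions by applying the case `p = 1` to a power, then extends to `u - t` by
truncation (`summable_norm_rpow_of_tendsto_zero`). -/

/-! ### Point differences as integrals against derivatives of test functions. -/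

theorem hasFDerivAt_comp_const_sub {ρ : Eucl d → ℝ} (hρ : Differentiable ℝ ρ) (x y : Eucl d) :
    HasFDerivAt (fun z => ρ (x - z)) (-(fderiv ℝ ρ (x - y))) y := by
  have h := (hρ (x - y)).hasFDerivAt.comp y ((hasFDerivAt_id y).const_sub x)
  have he : fderiv ℝ ρ (x - y) ∘SL (-ContinuousLinearMap.id ℝ (Eucl d)) = -(fderiv ℝ ρ (x - y)) := by
    ext v
    simp
  rw [← he]
  exact h

/-- A continuous function whose distributional derivative in direction `e` vanishes on a ball
takes equal values at the end points of the segment `[0, e]` in that ball. -/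
theorem eq_of_integral_fderiv_eq_zero {f : Eucl d → ℝ} (hf : Continuous f) (e : Eucl d) {R : ℝ}
    (hR : ‖e‖ < R)
    (h : ∀ φ : Eucl d → ℝ, ContDiff ℝ ∞ φ → HasCompactSupport φ →
      tsupport φ ⊆ Metric.ball 0 R → ∫ x, fderiv ℝ φ x e * f x = 0) : f e = f 0 := by
  -- Half the gap: a `δ`-ball centred on the segment `[0, e]` stays inside the ball of radius `R`,
  -- so translated mollifiers are admissible test functions.
  set δ : ℝ := (R - ‖e‖) / 2 with hδ
  have hδ0 : 0 < δ := by rw [hδ]; linarith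
  let b : ℕ → ContDiffBump (0 : Eucl d) := fun n =>
    { rIn := δ / (n + 1) / 2
      rOut := δ / (n + 1)
      rIn_pos := by positivity
      rIn_lt_rOut := half_lt_self (by positivity) }
  have hb : Filter.Tendsto (fun n => (b n).rOut) Filter.atTop (nhds 0) := by
    have := tendsto_one_div_add_atTop_nhds_zero_nat (𝕜 := ℝ) |>.const_mul δ
    simpa [b, div_eq_mul_inv] using this
  have hconv := fun x => ContDiffBump.convolution_tendsto_right_of_continuous
    (μ := (volume : Measure (Eucl d))) hb hf x
  refine tendsto_nhds_unique (hconv e) ?_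
  refine (hconv 0).congr fun n => ?_
  set ρ := (b n).normed (volume : Measure (Eucl d)) with hρdef
  have hρ : ContDiff ℝ ∞ ρ := (b n).contDiff_normed
  have hρc : HasCompactSupport ρ := (b n).hasCompactSupport_normed
  have hρs : tsupport ρ ⊆ Metric.closedBall 0 δ := by
    rw [hρdef, (b n).tsupport_normed_eq]
    refine Metric.closedBall_subset_closedBall ?_
    exact div_le_self hδ0.le (by simp)
  have hloc : LocallyIntegrable f volume := hf.locallyIntegrable
  have hder : ∀ x, HasFDerivAt (ρ ⋆[ContinuousLinearMap.lsmul ℝ ℝ, volume] f)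
      ((fderiv ℝ ρ ⋆[(ContinuousLinearMap.lsmul ℝ ℝ).precompL (Eucl d), volume] f) x) x := fun x =>
    hρc.hasFDerivAt_convolution_left _ (hρ.of_le (by simp)) hloc x
  have hz : ∀ x : Eucl d, ‖x‖ ≤ ‖e‖ →
      ((fderiv ℝ ρ ⋆[(ContinuousLinearMap.lsmul ℝ ℝ).precompL (Eucl d), volume] f) x) e = 0 := by
    intro x hx
    have hint : Integrable (fun t => (ContinuousLinearMap.lsmul ℝ ℝ).precompL (Eucl d)
        (fderiv ℝ ρ t) (f (x - t))) volume :=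
      (hρc.fderiv ℝ).convolutionExists_left _ (hρ.continuous_fderiv (by simp)) hloc x
    rw [convolution_def, ContinuousLinearMap.integral_apply hint,
      ← integral_sub_left_eq_self _ volume x]
    have h1 := h (fun y => ρ (x - y)) (hρ.comp (contDiff_const.sub contDiff_id))
      (hρc.comp_homeomorph (Homeomorph.subLeft x)) ?_
    · simp only [(hasFDerivAt_comp_const_sub (hρ.differentiable (by simp)) x _).fderiv] at h1
      rw [← neg_eq_zero, ← integral_neg, ← h1]
      congr 1
      ext y
      simp [ContinuousLinearMap.precompL_apply]
    · have hcl : IsClosed {y : Eucl d | x - y ∈ Metric.closedBall (0 : Eucl d) δ} :=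
        Metric.isClosed_closedBall.preimage (by fun_prop)
      refine (closure_minimal (t := {y | x - y ∈ Metric.closedBall (0 : Eucl d) δ}) ?_ hcl).trans ?_
      · intro y hy
        exact hρs (subset_tsupport _ hy)
      · intro y hy
        simp only [Set.mem_ofPred_eq, mem_closedBall_zero_iff] at hy
        rw [mem_ball_zero_iff]
        have := norm_sub_le x (x - y)
        rw [sub_sub_cancel] at this
        linarith
  have key := constant_of_has_deriv_right_zero (a := (0 : ℝ)) (b := 1)
    (f := fun t : ℝ => (ρ ⋆[ContinuousLinearMap.lsmul ℝ ℝ, volume] f) (t • e)) ?_ ?_ 1 (by simp)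
  · simpa using key.symm
  · refine Continuous.continuousOn ?_
    have : Continuous (ρ ⋆[ContinuousLinearMap.lsmul ℝ ℝ, volume] f) :=
      continuous_iff_continuousAt.2 fun x => (hder x).continuousAt
    fun_prop
  · intro t ht
    have h1 : HasDerivAt (fun t : ℝ => t • e) e t := by
      simpa using (hasDerivAt_id t).smul_const e
    have h2 := (hder (t • e)).comp_hasDerivAt t h1
    rw [hz] at h2
    · exact h2.hasDerivWithinAt
    · rw [norm_smul, Real.norm_of_nonneg ht.1]
      exact mul_le_of_le_one_left (norm_nonneg _) ht.2.le

/-- On finitely many continuous functions, the functional `z ↦ z e - z 0` is represented by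
the directional derivative of a test function supported in a ball containing the segment `[0, e]`. -/
theorem exists_testFunction_integral_fderiv_eq_sub {ι : Type*} [Fintype ι] {z : ι → Eucl d → ℝ}
    (hz : ∀ j, Continuous (z j)) (e : Eucl d) {R : ℝ} (hR : ‖e‖ < R) :
    ∃ φ : Eucl d → ℝ, ContDiff ℝ ∞ φ ∧ HasCompactSupport φ ∧ tsupport φ ⊆ Metric.ball 0 R ∧
      ∀ j, ∫ x, fderiv ℝ φ x e * z j x = z j e - z j 0 := by
  have hint : ∀ φ : Eucl d → ℝ, ContDiff ℝ ∞ φ → HasCompactSupport φ → ∀ j,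
      Integrable (fun x => fderiv ℝ φ x e * z j x) volume := by
    intro φ hφ hc j
    have h1 : Continuous (fun x => fderiv ℝ φ x e) :=
      (hφ.continuous_fderiv (by simp)).clm_apply continuous_const
    exact (h1.mul (hz j)).integrable_of_hasCompactSupport ((hc.fderiv_apply ℝ e).mul_right)
  -- The attainable vectors form a subspace. If the target were outside it, a functional vanishing
  -- on `W` but not at the target would give a combination of the `z j` contradicting the previous
  -- lemma.
  let W : Submodule ℝ (ι → ℝ) :=
    { carrier := {w | ∃ φ : Eucl d → ℝ, ContDiff ℝ ∞ φ ∧ HasCompactSupport φ ∧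
        tsupport φ ⊆ Metric.ball 0 R ∧ ∀ j, ∫ x, fderiv ℝ φ x e * z j x = w j}
      zero_mem' := ⟨0, contDiff_const, HasCompactSupport.zero, by simp [tsupport], by
        intro j
        have : fderiv ℝ (0 : Eucl d → ℝ) = 0 := by ext x; simp
        simp [this]⟩
      add_mem' := by
        rintro w w' ⟨φ, h1, h2, h3, h4⟩ ⟨φ', h1', h2', h3', h4'⟩
        refine ⟨φ + φ', h1.add h1', h2.add h2',
          (tsupport_add φ φ').trans (Set.union_subset h3 h3'), fun j => ?_⟩
        rw [Pi.add_apply, ← h4, ← h4', ← integral_add (hint φ h1 h2 j) (hint φ' h1' h2' j)]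
        congr 1
        ext x
        rw [fderiv_add (h1.differentiable (by simp) x) (h1'.differentiable (by simp) x)]
        simp [add_mul]
      smul_mem' := by
        rintro c w ⟨φ, h1, h2, h3, h4⟩
        refine ⟨c • φ, contDiff_const.smul h1, h2.smul_left (f := fun _ => c),
          (tsupport_smul_subset_right (fun _ => c) φ).trans h3, fun j => ?_⟩
        rw [Pi.smul_apply, ← h4, smul_eq_mul, ← integral_const_mul]
        congr 1
        ext x
        rw [fderiv_const_smul (h1.differentiable (by simp) x)]
        simp [mul_assoc] }
  classical
  by_contra hcon
  have hT : (fun j => z j e - z j 0) ∉ W := hcon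
  obtain ⟨ℓ, hℓ, hW⟩ := Submodule.exists_le_ker_of_notMem hT
  have hrep : ∀ w : ι → ℝ, ℓ w = ∑ j, ℓ (Pi.single j 1) * w j := by
    intro w
    conv_lhs => rw [pi_eq_sum_univ' w]
    simp [mul_comm]
  refine hℓ ?_
  have := eq_of_integral_fderiv_eq_zero (f := fun x => ∑ j, ℓ (Pi.single j 1) * z j x)
    (by fun_prop) e hR ?_
  · rw [hrep]
    simp only [mul_sub, Finset.sum_sub_distrib]
    exact sub_eq_zero.2 this
  · intro φ h1 h2 h3
    have hw : (fun j => ∫ x, fderiv ℝ φ x e * z j x) ∈ W := ⟨φ, h1, h2, h3, fun _ => rfl⟩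
    have := hW hw
    rw [LinearMap.mem_ker, hrep] at this
    rw [← this]
    simp only [Finset.mul_sum, ← integral_const_mul]
    rw [integral_finsetSum]
    · congr 1; ext j; congr 1; ext x; ring
    · intro j _
      have := (hint φ h1 h2 j).const_mul (ℓ (Pi.single j 1))
      refine this.congr (.of_forall fun x => ?_)
      simp only; ring

/-! ### Lattice points, translates of `ζ`, and the interpolant. -/

theorem IntLattice.toEucl_apply (ξ : IntLattice d) (i : Fin d) : ξ.toEucl i = (ξ i : ℝ) := rfl

theorem IntLattice.toEucl_zero : (0 : IntLattice d).toEucl = 0 := by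
  ext i; simp [IntLattice.toEucl_apply]

theorem IntLattice.toEucl_add (ξ η : IntLattice d) :
    IntLattice.toEucl (ξ + η) = ξ.toEucl + η.toEucl := by
  ext i; simp [IntLattice.toEucl_apply]

theorem IntLattice.toEucl_sub (ξ η : IntLattice d) :
    IntLattice.toEucl (ξ - η) = ξ.toEucl - η.toEucl := by
  ext i; simp [IntLattice.toEucl_apply]

theorem IntLattice.toEucl_single (i : Fin d) :
    IntLattice.toEucl (Pi.single i 1 : IntLattice d) = EuclideanSpace.single i (1 : ℝ) := by
  ext j
  by_cases h : j = i
  · subst h; simp [IntLattice.toEucl_apply]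
  · simp [IntLattice.toEucl_apply, h]

theorem abs_apply_le_norm (x : Eucl d) (i : Fin d) : |x i| ≤ ‖x‖ := by
  simpa using EuclideanSpace.norm_eq x ▸ PiLp.norm_apply_le x i

theorem interpolant_add_toEucl (ζ : Eucl d → ℝ) (u : LatticeFun d m) (ξ : IntLattice d)
    (x : Eucl d) :
    interpolant ζ u (x + ξ.toEucl) = interpolant ζ (fun η => u (η + ξ)) x := by
  unfold interpolant
  rw [← finsum_comp_equiv (Equiv.addRight ξ)]
  refine finsum_congr fun η => ?_
  simp [IntLattice.toEucl_add]

theorem IsNodalBasis.exists_support_bound {ζ : Eucl d → ℝ} (hζ : IsNodalBasis ζ) :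
    ∃ N : ℕ, ∀ x, ζ x ≠ 0 → ‖x‖ ≤ N := by
  obtain ⟨r, hr⟩ := hζ.locality.isBounded.exists_norm_le
  obtain ⟨N, hN⟩ := exists_nat_ge r
  exact ⟨N, fun x hx => (hr x (subset_tsupport _ hx)).trans hN⟩

theorem IsNodalBasis.apply_sub_toEucl {ζ : Eucl d → ℝ} (hζ : IsNodalBasis ζ)
    (ξ η : IntLattice d) : ζ (ξ.toEucl - η.toEucl) = if η = ξ then 1 else 0 := by
  rw [← IntLattice.toEucl_sub]
  split_ifs with h
  · rw [h, sub_self, IntLattice.toEucl_zero, hζ.zero_eq_one]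
  · exact hζ.eq_zero _ (sub_ne_zero.2 (Ne.symm h))

/-- The lattice translates of `ζ` that do not vanish at a given point are finite in number. -/
theorem IsNodalBasis.finite_support {ζ : Eucl d → ℝ} (hζ : IsNodalBasis ζ) (r : ℝ) :
    ∃ S : Finset (IntLattice d), ∀ x : Eucl d, ‖x‖ ≤ r → ∀ ξ ∉ S, ζ (x - ξ.toEucl) = 0 := by
  obtain ⟨N, hN⟩ := hζ.exists_support_bound
  obtain ⟨M, hM⟩ := exists_nat_ge r
  refine ⟨Fintype.piFinset fun _ => Finset.Icc (-((N + M : ℕ) : ℤ)) ((N + M : ℕ) : ℤ), ?_⟩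
  intro x hx ξ hξ
  by_contra h
  refine hξ ?_
  rw [Fintype.mem_piFinset]
  intro i
  have h1 : ‖ξ.toEucl‖ ≤ N + M := by
    have h2 := norm_sub_le x (x - ξ.toEucl)
    rw [sub_sub_cancel] at h2
    linarith [hN _ h]
  have h3 := (abs_apply_le_norm ξ.toEucl i).trans h1
  rw [IntLattice.toEucl_apply] at h3
  rw [Finset.mem_Icc, ← abs_le]
  refine (Int.cast_le (R := ℝ)).1 ?_
  push_cast
  exact h3

theorem IsNodalBasis.interpolant_add_const {ζ : Eucl d → ℝ} (hζ : IsNodalBasis ζ)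
    (u : LatticeFun d m) (t : Eucl m) (x : Eucl d) :
    interpolant ζ (fun ξ => u ξ + t) x = interpolant ζ u x + t := by
  obtain ⟨S, hS⟩ := hζ.finite_support ‖x‖
  have hS' := hS x le_rfl
  have h1 := hζ.order 1 0 x
  simp only [inner_zero_left, add_zero, mul_one] at h1
  have hsub : ∀ {M : Type} [AddCommMonoid M] [Module ℝ M] (w : IntLattice d → M),
      (Function.support fun ξ => ζ (x - ξ.toEucl) • w ξ) ⊆ S := by
    intro M _ _ w ξ hξ
    by_contra h
    exact hξ (by simp [hS' ξ h])
  unfold interpolant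
  rw [finsum_eq_sum_of_support_subset _ (hsub _), finsum_eq_sum_of_support_subset _ (hsub _)]
  rw [finsum_eq_sum_of_support_subset _ (s := S) (by simpa using hsub fun _ => (1 : ℝ))] at h1
  simp only [smul_add, Finset.sum_add_distrib]
  rw [← Finset.sum_smul, h1, one_smul]

/-! ### From the weak gradient of the interpolant to lattice differences. -/

/-- Finite differences of a lattice function are integrals of its interpolant against
derivatives of translates of one test function. -/
theorem IsNodalBasis.exists_testFunction {ζ : Eucl d → ℝ} (hζ : IsNodalBasis ζ) (m : ℕ)
    (i : Fin d) :
    ∃ φ : Eucl d → ℝ, ContDiff ℝ ∞ φ ∧ HasCompactSupport φ ∧ tsupport φ ⊆ Metric.ball 0 2 ∧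
      ∀ (u : LatticeFun d m) (ξ : IntLattice d),
        ∫ x, fderiv ℝ φ (x - ξ.toEucl) (EuclideanSpace.single i 1) • interpolant ζ u x =
          u (ξ + Pi.single i 1) - u ξ := by
  -- Any radius above `‖e‖ = 1` would do; `S` contains every translate that is seen by a test
  -- function supported in that ball.
  obtain ⟨S, hS⟩ := hζ.finite_support 2
  set e : Eucl d := EuclideanSpace.single i 1 with he
  have hcont : ∀ η : S, Continuous fun x => ζ (x - (η : IntLattice d).toEucl) := fun η =>
    hζ.continuous.comp (by fun_prop)
  obtain ⟨φ, h1, h2, h3, h4⟩ := exists_testFunction_integral_fderiv_eq_sub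
    hcont e (R := 2) (by simp [he])
  refine ⟨φ, h1, h2, h3, fun u ξ => ?_⟩
  -- Translating by `ξ` amounts to shifting `u`, so the `φ` built at the origin serves every `ξ`.
  rw [← integral_add_right_eq_self _ ξ.toEucl]
  simp only [add_sub_cancel_right, interpolant_add_toEucl]
  set w : LatticeFun d m := fun η => u (η + ξ) with hw
  have hz : ∀ x : Eucl d, ‖x‖ ≤ 2 →
      interpolant ζ w x = ∑ η : S, ζ (x - (η : IntLattice d).toEucl) • w η := by
    intro x hx
    unfold interpolant
    rw [Finset.sum_coe_sort S fun η => ζ (x - η.toEucl) • w η]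
    refine finsum_eq_sum_of_support_subset _ fun η hη => ?_
    by_contra h
    exact hη (by simp [hS x hx η h])
  have hval : ∀ η : IntLattice d, ‖η.toEucl‖ ≤ 2 → interpolant ζ w η.toEucl = w η := by
    intro η hη
    unfold interpolant
    rw [finsum_eq_single _ η]
    · rw [hζ.apply_sub_toEucl, if_pos rfl, one_smul]
    · intro η' h
      rw [hζ.apply_sub_toEucl, if_neg h, zero_smul]
  have hfin : ∀ x, fderiv ℝ φ x e • interpolant ζ w x =
      ∑ η : S, (fderiv ℝ φ x e * ζ (x - (η : IntLattice d).toEucl)) • w η := by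
    intro x
    by_cases hx : ‖x‖ ≤ 2
    · rw [hz x hx, Finset.smul_sum]
      simp only [smul_smul]
    · have : fderiv ℝ φ x = 0 := by
        by_contra hne
        have := h3 (support_fderiv_subset ℝ (Function.mem_support.2 hne))
        rw [mem_ball_zero_iff] at this
        exact hx this.le
      simp [this]
  simp only [hfin]
  rw [integral_finsetSum]
  · simp only [integral_smul_const, h4, sub_smul, Finset.sum_sub_distrib]
    have e1 := hval (Pi.single i 1) (by simp [IntLattice.toEucl_single])
    have e0 := hval 0 (by simp [IntLattice.toEucl_zero])
    rw [IntLattice.toEucl_single, hz _ (by simp)] at e1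
    rw [IntLattice.toEucl_zero, hz _ (by simp)] at e0
    rw [he, e1, e0, hw]
    simp [add_comm]
  · intro η _
    refine Integrable.smul_const ?_ _
    have hc : Continuous (fun x => fderiv ℝ φ x e) :=
      (h1.continuous_fderiv (by simp)).clm_apply continuous_const
    exact (hc.mul (hcont η)).integrable_of_hasCompactSupport ((h2.fderiv_apply ℝ e).mul_right)

/-- Finite differences of a lattice function are controlled by the local `L¹` norm of the weak
gradient of its interpolant. -/
theorem IsNodalBasis.exists_enorm_sub_le_lintegral {ζ : Eucl d → ℝ} (hζ : IsNodalBasis ζ) (m : ℕ)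
    (i : Fin d) :
    ∃ M : NNReal, ∀ (u : LatticeFun d m) (G : Eucl d → Eucl d →L[ℝ] Eucl m),
      IsWeakGradient (interpolant ζ u) G → ∀ ξ : IntLattice d,
        ‖u (ξ + Pi.single i 1) - u ξ‖ₑ ≤ M * ∫⁻ x in Metric.ball ξ.toEucl 2, ‖G x‖ₑ := by
  obtain ⟨φ, h1, h2, h3, h4⟩ := hζ.exists_testFunction m i
  obtain ⟨M, hM⟩ := h1.continuous.bounded_above_of_compact_support h2
  refine ⟨M.toNNReal, fun u G hG ξ => ?_⟩
  have hφ := hG.integral_eq (fun x => φ (x - ξ.toEucl)) (h1.comp (contDiff_id.sub contDiff_const))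
    (h2.comp_homeomorph (Homeomorph.subRight ξ.toEucl)) (EuclideanSpace.single i 1)
  have hfd : ∀ x, fderiv ℝ (fun x => φ (x - ξ.toEucl)) x = fderiv ℝ φ (x - ξ.toEucl) := fun x => by
    rw [fderiv_comp_sub]
  simp only [hfd, h4] at hφ
  rw [hφ, enorm_neg, ← lintegral_const_mul' _ _ ENNReal.coe_ne_top,
    ← lintegral_indicator Metric.isOpen_ball.measurableSet]
  refine (enorm_integral_le_lintegral_enorm _).trans (lintegral_mono fun x => ?_)
  by_cases hx : x ∈ Metric.ball ξ.toEucl 2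
  · rw [Set.indicator_of_mem hx, enorm_smul]
    have e1 : ‖φ (x - ξ.toEucl)‖ₑ ≤ (M.toNNReal : ℝ≥0∞) := by
      rw [← ofReal_norm]
      exact ENNReal.ofReal_le_ofReal (hM _)
    have e2 : ‖G x (EuclideanSpace.single i 1)‖ₑ ≤ ‖G x‖ₑ := by
      rw [← ofReal_norm, ← ofReal_norm]
      exact ENNReal.ofReal_le_ofReal (by simpa using (G x).le_opNorm (EuclideanSpace.single i 1))
    gcongr
  · have : φ (x - ξ.toEucl) = 0 := by
      by_contra hne
      have := h3 (subset_tsupport _ (Function.mem_support.2 hne))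
      exact hx (by simpa [dist_eq_norm] using this)
    simp [this]

/-- Balls of radius `2` around lattice points have bounded overlap. -/
theorem tsum_setLIntegral_ball_le {f : Eucl d → ℝ≥0∞} (hf : AEMeasurable f volume) :
    ∑' ξ : IntLattice d, ∫⁻ x in Metric.ball ξ.toEucl 2, f x ≤ 6 ^ d * ∫⁻ x, f x := by
  simp only [← lintegral_indicator Metric.isOpen_ball.measurableSet]
  rw [← lintegral_tsum fun ξ => hf.indicator Metric.isOpen_ball.measurableSet,
    ← lintegral_const_mul' _ _ (by simp)]
  refine lintegral_mono fun x => ?_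
  -- If `x` is within `2` of `ξ`, each `ξ i` lies strictly between `⌊x i⌋ - 2` and `⌊x i⌋ + 3`; six
  -- candidates per coordinate suffice.
  set T : Finset (IntLattice d) := Fintype.piFinset fun i => Finset.Icc (⌊x i⌋ - 2) (⌊x i⌋ + 3)
  have hT : T.card = 6 ^ d := by
    simp only [T, Fintype.card_piFinset, Int.card_Icc]
    have : ∀ i : Fin d, (⌊x i⌋ + 3 + 1 - (⌊x i⌋ - 2)).toNat = 6 := fun i => by omega
    simp [this]
  rw [tsum_eq_sum (s := T)]
  · refine (Finset.sum_le_card_nsmul T _ (f x) fun ξ _ => Set.indicator_le_self _ _ _).trans ?_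
    rw [hT, nsmul_eq_mul]
    simp
  · intro ξ hξ
    refine Set.indicator_of_notMem (fun hx => hξ ?_) _
    rw [Metric.mem_ball, dist_eq_norm] at hx
    rw [Fintype.mem_piFinset]
    intro i
    have h1 := (abs_apply_le_norm (x - ξ.toEucl) i).trans_lt hx
    rw [PiLp.sub_apply, IntLattice.toEucl_apply, abs_lt] at h1
    have h2 := Int.floor_le (x i)
    have h3 := Int.lt_floor_add_one (x i)
    rw [Finset.mem_Icc]
    constructor
    · have : (⌊x i⌋ : ℝ) - 2 < ξ i := by linarith
      exact_mod_cast this.le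
    · have : (ξ i : ℝ) < ⌊x i⌋ + 3 := by linarith
      exact_mod_cast this.le

/-- Finite differences of a lattice function are controlled in `ℓ^p` by the `L^p` norm of the weak
gradient of its interpolant. -/
theorem IsNodalBasis.exists_tsum_enorm_sub_rpow_le {ζ : Eucl d → ℝ} (hζ : IsNodalBasis ζ) (m : ℕ)
    {p : ℝ} (hp : 1 ≤ p) (i : Fin d) :
    ∃ C : NNReal, ∀ (u : LatticeFun d m) (G : Eucl d → Eucl d →L[ℝ] Eucl m),
      IsWeakGradient (interpolant ζ u) G →
        ∑' ξ : IntLattice d, ‖u (ξ + Pi.single i 1) - u ξ‖ₑ ^ p ≤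
          (C * eLpNorm G (ENNReal.ofReal p) volume) ^ p := by
  obtain ⟨M, hM⟩ := hζ.exists_enorm_sub_le_lintegral m i
  have hp0 : 0 < p := by linarith
  set V : ℝ≥0∞ := volume (Metric.ball (0 : Eucl d) 2) ^ (1 - 1 / p) with hV
  have hVtop : V ≠ ⊤ := ENNReal.rpow_ne_top_of_nonneg
    (by rw [sub_nonneg, div_le_one hp0]; exact hp) measure_ball_lt_top.ne
  have hKtop : ((6 : ℝ≥0∞) ^ d) ^ (1 / p) ≠ ⊤ :=
    ENNReal.rpow_ne_top_of_nonneg (by positivity) (by simp)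
  refine ⟨M * V.toNNReal * (((6 : ℝ≥0∞) ^ d) ^ (1 / p)).toNNReal, fun u G hG => ?_⟩
  have hmeas : AEStronglyMeasurable G volume := hG.locallyIntegrable_grad.aestronglyMeasurable
  have hloc : ∀ ξ : IntLattice d, ‖u (ξ + Pi.single i 1) - u ξ‖ₑ ^ p ≤
      (M * V) ^ p * ∫⁻ x in Metric.ball ξ.toEucl 2, ‖G x‖ₑ ^ p := by
    intro ξ
    have h1 := eLpNorm_le_eLpNorm_mul_rpow_measure_univ (p := 1) (q := ENNReal.ofReal p)
      (μ := volume.restrict (Metric.ball ξ.toEucl 2)) (by simpa using hp) hmeas.restrict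
    rw [eLpNorm_one_eq_lintegral_enorm, Measure.restrict_apply_univ, Measure.addHaar_ball_center,
      ENNReal.toReal_ofReal hp0.le, ENNReal.toReal_one, div_one, ← hV,
      eLpNorm_eq_lintegral_rpow_enorm_toReal (by simpa using hp0) (by simp),
      ENNReal.toReal_ofReal hp0.le] at h1
    calc ‖u (ξ + Pi.single i 1) - u ξ‖ₑ ^ p
        ≤ (M * ((∫⁻ x in Metric.ball ξ.toEucl 2, ‖G x‖ₑ ^ p) ^ (1 / p) * V)) ^ p := by
          gcongr
          exact (hM u G hG ξ).trans (by gcongr)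
      _ = _ := by
          rw [mul_comm _ V, ← mul_assoc, ENNReal.mul_rpow_of_nonneg _ _ hp0.le,
            ← ENNReal.rpow_mul, one_div, inv_mul_cancel₀ hp0.ne', ENNReal.rpow_one]
  calc ∑' ξ : IntLattice d, ‖u (ξ + Pi.single i 1) - u ξ‖ₑ ^ p
      ≤ ∑' ξ : IntLattice d, (M * V) ^ p * ∫⁻ x in Metric.ball ξ.toEucl 2, ‖G x‖ₑ ^ p :=
        ENNReal.tsum_le_tsum hloc
    _ ≤ (M * V) ^ p * (6 ^ d * ∫⁻ x, ‖G x‖ₑ ^ p) := by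
        rw [ENNReal.tsum_mul_left]
        gcongr
        exact tsum_setLIntegral_ball_le (hmeas.enorm.pow_const p)
    _ = _ := by
        rw [eLpNorm_eq_lintegral_rpow_enorm_toReal (by simpa using hp0) (by simp),
          ENNReal.toReal_ofReal hp0.le, ENNReal.coe_mul, ENNReal.coe_mul,
          ENNReal.coe_toNNReal hVtop, ENNReal.coe_toNNReal hKtop]
        simp only [ENNReal.mul_rpow_of_nonneg _ _ hp0.le, ← ENNReal.rpow_mul, one_div,
          inv_mul_cancel₀ hp0.ne', ENNReal.rpow_one]
        ring

/-! ### Independence of the representative of a class. -/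

theorem IsWeakGradient.add_const {F : Type*} [NormedAddCommGroup F] [NormedSpace ℝ F] [CompleteSpace F]
    {f : Eucl d → F} {G : Eucl d → Eucl d →L[ℝ] F} (hG : IsWeakGradient f G) (c : F) :
    IsWeakGradient (fun x => f x + c) G := by
  refine ⟨hG.locallyIntegrable.add (locallyIntegrable_const c), hG.locallyIntegrable_grad, ?_⟩
  intro φ hφ hc v
  have hcont : Continuous (fun x => fderiv ℝ φ x v) :=
    (hφ.continuous_fderiv (by simp)).clm_apply continuous_const
  have hcs : HasCompactSupport (fun x => fderiv ℝ φ x v) := hc.fderiv_apply ℝ v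
  have hi : Integrable (fun x => fderiv ℝ φ x v) volume := hcont.integrable_of_hasCompactSupport hcs
  have h0 : ∫ x, fderiv ℝ φ x v = 0 := by
    have := integral_mul_fderiv_eq_neg_fderiv_mul_of_integrable (μ := volume) (𝕜 := ℝ)
      (f := fun _ : Eucl d => (1 : ℝ)) (g := φ) (v := v) (by simp) (by simpa using hi)
      (by simpa using hφ.continuous.integrable_of_hasCompactSupport hc)
      (fun _ _ => differentiableAt_const _) (fun x _ => hφ.differentiable (by simp) x)
    simpa using this
  simp only [smul_add]
  rw [integral_add, integral_smul_const, h0, zero_smul, add_zero, hG.integral_eq φ hφ hc v]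
  · exact hG.locallyIntegrable.integrable_smul_left_of_hasCompactSupport hcont hcs
  · exact hi.smul_const c

/-- Membership of the class only says that some representative has finite seminorm. Since the
translates of `ζ` sum to `1`, interpolants of representatives differ by constants and share their
weak gradients. -/
theorem IsNodalBasis.latticeSeminorm_lt_top {ζ : Eucl d → ℝ} (hζ : IsNodalBasis ζ) {p : ℝ≥0∞}
    {u : LatticeFun d m} (hu : translationClass u ∈ homogeneousSpace ζ m p) :
    latticeSeminorm ζ p u < ⊤ := by
  obtain ⟨w, hw, hlt⟩ := hu
  have hmem : u ∈ translationClass w := hw ▸ ⟨0, by simp⟩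
  obtain ⟨t, rfl⟩ := hmem
  refine lt_of_le_of_lt ?_ hlt
  unfold latticeSeminorm gradNorm
  refine le_iInf₂ fun G hG => iInf₂_le G ?_
  have := hG.add_const t
  rwa [show interpolant ζ (fun ξ => w ξ + t) = fun x => interpolant ζ w x + t from
    funext fun x => hζ.interpolant_add_const w t x]

/-- The finite differences of `u` are controlled in `ℓ^p` by `‖u‖_{𝒰^{1,p}}`. -/
theorem IsNodalBasis.exists_tsum_enorm_sub_rpow_le_latticeSeminorm {ζ : Eucl d → ℝ}
    (hζ : IsNodalBasis ζ) (m : ℕ) {p : ℝ} (hp : 1 ≤ p) :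
    ∃ C : ℝ, 0 ≤ C ∧ ∀ u : LatticeFun d m,
      translationClass u ∈ homogeneousSpace ζ m (ENNReal.ofReal p) → ∀ i : Fin d,
        ∑' ξ : IntLattice d, ‖u (ξ + Pi.single i 1) - u ξ‖ₑ ^ p ≤
          ENNReal.ofReal (C * (latticeSeminorm ζ (ENNReal.ofReal p) u).toReal) ^ p := by
  choose C hC using fun i => hζ.exists_tsum_enorm_sub_rpow_le m hp i
  refine ⟨((∑ i, C i : NNReal) : ℝ), NNReal.coe_nonneg _, fun u hu i => ?_⟩
  have hlt := hζ.latticeSeminorm_lt_top hu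
  rw [ENNReal.ofReal_mul (NNReal.coe_nonneg _), ENNReal.ofReal_toReal hlt.ne,
    ENNReal.ofReal_coe_nnreal]
  -- Without a weak gradient the infimum defining the seminorm would be over an empty family, hence
  -- `⊤`.
  obtain ⟨G, hG⟩ : ∃ G, IsWeakGradient (interpolant ζ u) G := by
    by_contra hno
    push Not at hno
    simp [latticeSeminorm, gradNorm, hno] at hlt
  refine (hC i u G hG).trans ?_
  unfold latticeSeminorm
  rw [gradNorm_eq hG]
  gcongr
  exact Finset.single_le_sum (fun _ _ => zero_le) (Finset.mem_univ i)

/-! ### Sums of differences along coordinate paths. -/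

section Differences

variable {E : Type*} [NormedAddCommGroup E]

/-- The `ℓ^p` norms of all coordinate differences of `u` are at most `a`. -/
def DifferencesBoundedBy (u : IntLattice d → E) (p a : ℝ) : Prop :=
  ∀ (i : Fin d) (s : Finset (IntLattice d)),
    ∑ ξ ∈ s, ‖u (ξ + Pi.single i 1) - u ξ‖ ^ p ≤ a ^ p

theorem differencesBoundedBy_of_tsum_le {u : IntLattice d → E} {p a : ℝ} (hp : 0 ≤ p) (ha : 0 ≤ a)
    (h : ∀ i : Fin d, ∑' ξ : IntLattice d, ‖u (ξ + Pi.single i 1) - u ξ‖ₑ ^ p ≤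
      ENNReal.ofReal a ^ p) : DifferencesBoundedBy u p a := by
  intro i s
  have h1 := (ENNReal.sum_le_tsum s).trans (h i)
  rw [ENNReal.ofReal_rpow_of_nonneg ha hp] at h1
  simp only [← ofReal_norm, ENNReal.ofReal_rpow_of_nonneg (norm_nonneg _) hp] at h1
  rw [← ENNReal.ofReal_sum_of_nonneg fun _ _ => by positivity] at h1
  exact (ENNReal.ofReal_le_ofReal_iff (by positivity)).1 h1

theorem DifferencesBoundedBy.sum_norm_le {u : IntLattice d → E} {p a : ℝ}
    (h : DifferencesBoundedBy u p a) (hp : 1 ≤ p) (ha : 0 ≤ a) (i : Fin d)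
    (s : Finset (IntLattice d)) :
    ∑ ξ ∈ s, ‖u (ξ + Pi.single i 1) - u ξ‖ ≤ (s.card : ℝ) ^ (1 - 1 / p) * a := by
  have hp0 : 0 < p := by linarith
  have h1 := Real.rpow_sum_le_const_mul_sum_rpow s (fun ξ => ‖u (ξ + Pi.single i 1) - u ξ‖) hp
  simp only [abs_norm] at h1
  refine (Real.rpow_le_rpow_iff (by positivity) (by positivity) hp0).1 ?_
  rw [Real.mul_rpow (by positivity) ha, ← Real.rpow_mul (by positivity),
    show (1 - 1 / p) * p = p - 1 by field_simp]
  exact h1.trans (by gcongr; exact h i s)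

theorem norm_add_single_sub_le (u : IntLattice d → E) (y : IntLattice d) (i : Fin d) (k : ℕ) :
    ‖u (y + Pi.single i (k : ℤ)) - u y‖ ≤
      ∑ j ∈ Finset.range k,
        ‖u (y + Pi.single i (j : ℤ) + Pi.single i 1) - u (y + Pi.single i (j : ℤ))‖ := by
  have h := Finset.sum_range_sub (fun j : ℕ => u (y + Pi.single i (j : ℤ))) k
  simp only [Nat.cast_zero, Pi.single_zero, add_zero] at h
  rw [← h]
  refine (norm_sum_le _ _).trans_eq (Finset.sum_congr rfl fun j _ => ?_)
  rw [add_assoc y, ← Pi.single_add]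
  norm_cast

/-- As the bound is uniform in the base point, a negative step is a positive one started from the
other end. -/
theorem norm_add_single_sub_le_natAbs {u : IntLattice d → E} {i : Fin d} {c : ℕ → ℝ}
    (h : ∀ (y : IntLattice d) (k : ℕ), ‖u (y + Pi.single i (k : ℤ)) - u y‖ ≤ c k)
    (y : IntLattice d) (k : ℤ) : ‖u (y + Pi.single i k) - u y‖ ≤ c k.natAbs := by
  rcases Int.natAbs_eq k with hk | hk
  · have := h y k.natAbs
    rwa [← hk] at this
  · have := h (y + Pi.single i k) k.natAbs
    rwa [add_assoc, ← Pi.single_add, show k + (k.natAbs : ℤ) = 0 by omega, Pi.single_zero,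
      add_zero, norm_sub_rev] at this

theorem norm_add_sub_le_sum {u : IntLattice d → E} {c : ℕ → ℝ}
    (h : ∀ (i : Fin d) (y : IntLattice d) (k : ℕ), ‖u (y + Pi.single i (k : ℤ)) - u y‖ ≤ c k)
    (y η : IntLattice d) : ‖u (y + η) - u y‖ ≤ ∑ i, c (η i).natAbs := by
  have key : ∀ s : Finset (Fin d), ‖u (y + ∑ i ∈ s, Pi.single i (η i)) - u y‖ ≤
      ∑ i ∈ s, c (η i).natAbs := by
    intro s
    induction s using Finset.induction_on with
    | empty => simp
    | insert i s hi ih =>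
      rw [Finset.sum_insert hi, Finset.sum_insert hi, add_comm (Pi.single i (η i) : IntLattice d),
        ← add_assoc]
      exact (norm_sub_le_norm_sub_add_norm_sub _ (u (y + ∑ i ∈ s, Pi.single i (η i))) _).trans
        (add_le_add (norm_add_single_sub_le_natAbs (h i) _ _) ih)
  have := key Finset.univ
  rwa [Finset.univ_sum_single] at this

theorem natAbs_le_norm_toEucl (ξ : IntLattice d) (i : Fin d) :
    ((ξ i).natAbs : ℝ) ≤ ‖ξ.toEucl‖ := by
  rw [Nat.cast_natAbs, Int.cast_abs]
  exact abs_apply_le_norm ξ.toEucl i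

/-- A path from `0` to `ξ` has one straight piece per coordinate, of at most `‖ξ‖` steps; Hölder on
a piece of `k` steps costs `k ^ (1 - 1 / p)`. -/
theorem DifferencesBoundedBy.norm_sub_le_rpow {u : IntLattice d → E} {p a : ℝ}
    (h : DifferencesBoundedBy u p a) (hp : 1 ≤ p) (ha : 0 ≤ a) (ξ : IntLattice d) :
    ‖u ξ - u 0‖ ≤ d * a * ‖ξ.toEucl‖ ^ (1 - 1 / p) := by
  have hp0 : 0 < p := by linarith
  have he : 0 ≤ 1 - 1 / p := by rw [sub_nonneg, div_le_one hp0]; exact hp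
  have h1 := norm_add_sub_le_sum (u := u) (c := fun k => (k : ℝ) ^ (1 - 1 / p) * a) ?_ 0 ξ
  · rw [zero_add] at h1
    refine h1.trans ?_
    calc ∑ i, ((ξ i).natAbs : ℝ) ^ (1 - 1 / p) * a
        ≤ ∑ _i : Fin d, ‖ξ.toEucl‖ ^ (1 - 1 / p) * a := by
          gcongr with i
          exact natAbs_le_norm_toEucl ξ i
      _ = _ := by simp; ring
  · intro i y k
    refine (norm_add_single_sub_le u y i k).trans ?_
    have hinj : Function.Injective fun j : ℕ => y + (Pi.single i (j : ℤ) : IntLattice d) := by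
      intro j j' hj
      simpa using hj
    have := h.sum_norm_le hp ha i ((Finset.range k).map ⟨_, hinj⟩)
    simpa using this

end Differences

/-! ### Averages over cubes and logarithmic growth. -/

section Averages

variable {E : Type*} [NormedAddCommGroup E] [NormedSpace ℝ E]

/-- The lattice cube `{0, …, n - 1}ᵈ`. -/
noncomputable def latticeBox (d n : ℕ) : Finset (IntLattice d) := Fintype.piFinset fun _ => Finset.Ico 0 (n : ℤ)

theorem card_latticeBox (d n : ℕ) : (latticeBox d n).card = n ^ d := by
  simp [latticeBox]

/-- The average of `u` over the cube of side `n` with corner `y`. -/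
noncomputable def boxAverage (n : ℕ) (u : IntLattice d → E) (y : IntLattice d) : E :=
  ((n : ℝ) ^ d)⁻¹ • ∑ z ∈ latticeBox d n, u (y + z)

theorem boxAverage_one (u : IntLattice d → E) (y : IntLattice d) : boxAverage 1 u y = u y := by
  have : latticeBox d 1 = {0} := by
    ext z
    simp only [latticeBox, Fintype.mem_piFinset, Finset.mem_Ico, Finset.mem_singleton,
      funext_iff, Pi.zero_apply]
    exact forall_congr' fun i => by omega
  simp [boxAverage, this]

/-- The double average is the intermediary through which averages at two scales are compared. -/
theorem boxAverage_comm (n N : ℕ) (u : IntLattice d → E) (y : IntLattice d) :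
    boxAverage n (boxAverage N u) y = boxAverage N (boxAverage n u) y := by
  simp only [boxAverage, ← Finset.smul_sum]
  rw [smul_comm, Finset.sum_comm]
  congr 2
  exact Finset.sum_congr rfl fun z _ => Finset.sum_congr rfl fun z' _ => by
    rw [add_right_comm]

theorem norm_boxAverage_sub_le {u : IntLattice d → E} {n : ℕ} (hn : 0 < n) {y : IntLattice d}
    {w : E} {b : ℝ} (h : ∀ z ∈ latticeBox d n, ‖u (y + z) - w‖ ≤ b) :
    ‖boxAverage n u y - w‖ ≤ b := by
  have hpos : (0 : ℝ) < (n : ℝ) ^ d := by positivity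
  have : boxAverage n u y - w = ((n : ℝ) ^ d)⁻¹ • ∑ z ∈ latticeBox d n, (u (y + z) - w) := by
    rw [Finset.sum_sub_distrib, smul_sub, Finset.sum_const, card_latticeBox, boxAverage,
      ← Nat.cast_smul_eq_nsmul ℝ, Nat.cast_pow, inv_smul_smul₀ hpos.ne']
  rw [this, norm_smul, Real.norm_of_nonneg (by positivity), inv_mul_le_iff₀ hpos]
  refine (norm_sum_le_of_le _ h).trans_eq ?_
  simp [card_latticeBox]

/-- Each unit shift changes the average by a mean of `n ^ d` differences, and Hölder gains the
factor `(n ^ d) ^ (-(1 / p))`. -/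
theorem DifferencesBoundedBy.norm_boxAverage_add_single_sub_le {u : IntLattice d → E} {p a : ℝ}
    (h : DifferencesBoundedBy u p a) (hp : 1 ≤ p) (ha : 0 ≤ a) {n : ℕ} (hn : 0 < n) (i : Fin d)
    (y : IntLattice d) (k : ℕ) :
    ‖boxAverage n u (y + Pi.single i (k : ℤ)) - boxAverage n u y‖ ≤
      k * (((n : ℝ) ^ d) ^ (-(1 / p)) * a) := by
  have hpos : (0 : ℝ) < (n : ℝ) ^ d := by positivity
  have hinj : ∀ j : ℕ, Function.Injective fun z => y + z + (Pi.single i (j : ℤ) : IntLattice d) :=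
    fun j z z' hz => by simpa using hz
  rw [boxAverage, boxAverage, ← smul_sub, ← Finset.sum_sub_distrib, norm_smul,
    Real.norm_of_nonneg (by positivity), inv_mul_le_iff₀ hpos]
  calc ‖∑ z ∈ latticeBox d n, (u (y + Pi.single i (k : ℤ) + z) - u (y + z))‖
      ≤ ∑ z ∈ latticeBox d n, ∑ j ∈ Finset.range k,
          ‖u (y + z + Pi.single i (j : ℤ) + Pi.single i 1) - u (y + z + Pi.single i (j : ℤ))‖ := by
        refine norm_sum_le_of_le _ fun z _ => ?_
        have := norm_add_single_sub_le u (y + z) i k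
        rwa [add_right_comm y z (Pi.single i (k : ℤ) : IntLattice d)] at this
    _ = ∑ j ∈ Finset.range k, ∑ z ∈ latticeBox d n,
          ‖u (y + z + Pi.single i (j : ℤ) + Pi.single i 1) - u (y + z + Pi.single i (j : ℤ))‖ := by
        rw [Finset.sum_comm]
    _ ≤ ∑ _j ∈ Finset.range k, ((n : ℝ) ^ d) ^ (1 - 1 / p) * a := by
        refine Finset.sum_le_sum fun j _ => ?_
        have := h.sum_norm_le hp ha i ((latticeBox d n).map ⟨_, hinj j⟩)
        rw [Finset.sum_map, Finset.card_map, card_latticeBox, Nat.cast_pow] at this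
        exact this
    _ = _ := by
        rw [Finset.sum_const, Finset.card_range, nsmul_eq_mul, sub_eq_add_neg,
          Real.rpow_add hpos, Real.rpow_one]
        ring

theorem DifferencesBoundedBy.norm_boxAverage_add_sub_le {u : IntLattice d → E} {p a : ℝ}
    (h : DifferencesBoundedBy u p a) (hp : 1 ≤ p) (ha : 0 ≤ a) {n : ℕ} (hn : 0 < n)
    (y η : IntLattice d) {r : ℝ} (hη : ∀ i, ((η i).natAbs : ℝ) ≤ r) :
    ‖boxAverage n u (y + η) - boxAverage n u y‖ ≤ d * r * (((n : ℝ) ^ d) ^ (-(1 / p)) * a) := by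
  refine (norm_add_sub_le_sum (h.norm_boxAverage_add_single_sub_le hp ha hn) y η).trans ?_
  calc ∑ i, ((η i).natAbs : ℝ) * (((n : ℝ) ^ d) ^ (-(1 / p)) * a)
      ≤ ∑ _i : Fin d, r * (((n : ℝ) ^ d) ^ (-(1 / p)) * a) := by
        gcongr with i
        exact hη i
    _ = _ := by simp; ring

theorem natAbs_le_of_mem_latticeBox {n : ℕ} {z : IntLattice d} (hz : z ∈ latticeBox d n)
    (i : Fin d) : ((z i).natAbs : ℝ) ≤ n := by
  rw [latticeBox, Fintype.mem_piFinset] at hz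
  have := Finset.mem_Ico.1 (hz i)
  exact_mod_cast (by omega : (z i).natAbs ≤ n)

theorem DifferencesBoundedBy.norm_boxAverage_sub_boxAverage_le {u : IntLattice d → E} {p a : ℝ}
    (h : DifferencesBoundedBy u p a) (hp : 1 ≤ p) (ha : 0 ≤ a) {n N : ℕ} (hn : 0 < n)
    (hN : 0 < N) (y : IntLattice d) :
    ‖boxAverage N u y - boxAverage n u y‖ ≤
      d * (n * ((N : ℝ) ^ d) ^ (-(1 / p)) + N * ((n : ℝ) ^ d) ^ (-(1 / p))) * a := by
  have h1 : ‖boxAverage n (boxAverage N u) y - boxAverage N u y‖ ≤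
      d * n * (((N : ℝ) ^ d) ^ (-(1 / p)) * a) :=
    norm_boxAverage_sub_le hn fun z hz =>
      h.norm_boxAverage_add_sub_le hp ha hN y z (natAbs_le_of_mem_latticeBox hz)
  have h2 : ‖boxAverage N (boxAverage n u) y - boxAverage n u y‖ ≤
      d * N * (((n : ℝ) ^ d) ^ (-(1 / p)) * a) :=
    norm_boxAverage_sub_le hN fun z hz =>
      h.norm_boxAverage_add_sub_le hp ha hn y z (natAbs_le_of_mem_latticeBox hz)
  rw [boxAverage_comm, norm_sub_rev] at h1
  have := norm_sub_le_norm_sub_add_norm_sub (boxAverage N u y)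
    (boxAverage N (boxAverage n u) y) (boxAverage n u y)
  linarith

/-- The ratio `2 ^ (1 - d / p)` decides the growth: it is `1` at `p = d` and less than `1` for `p <
d`. The factor `3` is `1 + 2`, from the side lengths `2 ^ k` and `2 ^ (k + 1)`. -/
theorem DifferencesBoundedBy.norm_boxAverage_two_pow_succ_sub_le {u : IntLattice d → E} {p a : ℝ}
    (h : DifferencesBoundedBy u p a) (hp : 1 ≤ p) (ha : 0 ≤ a) (k : ℕ) (y : IntLattice d) :
    ‖boxAverage (2 ^ (k + 1)) u y - boxAverage (2 ^ k) u y‖ ≤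
      3 * d * a * ((2 : ℝ) ^ (1 - d / p)) ^ k := by
  refine (h.norm_boxAverage_sub_boxAverage_le hp ha (by positivity) (by positivity) y).trans ?_
  have hp0 : 0 < p := by linarith
  have h1 : (((2 ^ (k + 1) : ℕ) : ℝ) ^ d) ^ (-(1 / p)) ≤ (((2 ^ k : ℕ) : ℝ) ^ d) ^ (-(1 / p)) := by
    refine Real.rpow_le_rpow_of_nonpos (by positivity) ?_ (by simp; positivity)
    gcongr <;> simp
  have h2 : ((2 ^ k : ℕ) : ℝ) * (((2 ^ k : ℕ) : ℝ) ^ d) ^ (-(1 / p)) =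
      ((2 : ℝ) ^ (1 - d / p)) ^ k := by
    rw [← Real.rpow_natCast, ← Real.rpow_mul (by positivity), ← Real.rpow_natCast,
      ← Real.rpow_mul (by positivity)]
    nth_rewrite 1 [← Real.rpow_one ((2 ^ k : ℕ) : ℝ)]
    rw [← Real.rpow_add (by positivity), Nat.cast_pow, Nat.cast_ofNat, ← Real.rpow_natCast,
      ← Real.rpow_mul (by positivity)]
    congr 1
    ring
  calc _ ≤ d * (((2 ^ k : ℕ) : ℝ) * (((2 ^ k : ℕ) : ℝ) ^ d) ^ (-(1 / p)) +
        ((2 ^ (k + 1) : ℕ) : ℝ) * (((2 ^ k : ℕ) : ℝ) ^ d) ^ (-(1 / p))) * a := by gcongr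
    _ = 3 * d * a * (((2 ^ k : ℕ) : ℝ) * (((2 ^ k : ℕ) : ℝ) ^ d) ^ (-(1 / p))) := by
        push_cast; ring
    _ = _ := by rw [h2]

/-- Logarithmic growth in the critical case. -/
theorem DifferencesBoundedBy.norm_sub_le_log {u : IntLattice d → E} {a : ℝ}
    (h : DifferencesBoundedBy u d a) (hd : 1 ≤ d) (ha : 0 ≤ a) {ξ : IntLattice d} (hξ : ξ ≠ 0) :
    ‖u ξ - u 0‖ ≤ 13 * d * a * (1 + Real.log ‖ξ.toEucl‖) := by
  have hd' : (1 : ℝ) ≤ d := by exact_mod_cast hd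
  have hd0 : (d : ℝ) ≠ 0 := by positivity
  have hnorm : 1 ≤ ‖ξ.toEucl‖ := by
    obtain ⟨i, hi⟩ := Function.ne_iff.1 hξ
    refine le_trans ?_ (natAbs_le_norm_toEucl ξ i)
    have : (ξ i).natAbs ≠ 0 := Int.natAbs_ne_zero.2 hi
    exact_mod_cast Nat.one_le_iff_ne_zero.2 this
  have hlog : 0 ≤ Real.log ‖ξ.toEucl‖ := Real.log_nonneg hnorm
  -- The first dyadic scale reaching `‖ξ‖`: there the averages at `ξ` and at `0` differ by only `d *
  -- a`.
  set K : ℕ := ⌈Real.log ‖ξ.toEucl‖ / Real.log 2⌉₊ with hK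
  have hlog2 : 0 < Real.log 2 := Real.log_pos (by norm_num)
  have hK1 : ‖ξ.toEucl‖ ≤ 2 ^ K := by
    rw [← Real.log_le_log_iff (by linarith) (by positivity), Real.log_pow, ← div_le_iff₀ hlog2]
    exact Nat.le_ceil _
  have hK2 : (K : ℝ) ≤ 2 * Real.log ‖ξ.toEucl‖ + 1 := by
    refine (Nat.ceil_lt_add_one (by positivity)).le.trans ?_
    gcongr
    rw [div_le_iff₀ hlog2]
    nlinarith [Real.log_two_gt_d9]
  have hstep : ∀ (k : ℕ) (y : IntLattice d),
      ‖boxAverage (2 ^ k) u y - u y‖ ≤ k * (3 * d * a) := by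
    intro k y
    induction k with
    | zero => simp [boxAverage_one]
    | succ k ih =>
      have h1 := h.norm_boxAverage_two_pow_succ_sub_le hd' ha k y
      rw [div_self hd0, sub_self, Real.rpow_zero, one_pow, mul_one] at h1
      have h2 := norm_sub_le_norm_sub_add_norm_sub (boxAverage (2 ^ (k + 1)) u y)
        (boxAverage (2 ^ k) u y) (u y)
      push_cast
      linarith
  have hfar := h.norm_boxAverage_add_sub_le hd' ha (n := 2 ^ K) (by positivity) 0 ξ
    (natAbs_le_norm_toEucl ξ)
  rw [zero_add, ← Real.rpow_natCast, ← Real.rpow_mul (by positivity),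
    show (d : ℝ) * -(1 / (d : ℝ)) = -1 by field_simp, Real.rpow_neg_one] at hfar
  have hfar' : ‖boxAverage (2 ^ K) u ξ - boxAverage (2 ^ K) u 0‖ ≤ d * a := by
    refine hfar.trans ?_
    push_cast
    have : ‖ξ.toEucl‖ * ((2 : ℝ) ^ K)⁻¹ ≤ 1 := by
      rw [mul_inv_le_iff₀ (by positivity), one_mul]; exact hK1
    calc d * ‖ξ.toEucl‖ * (((2 : ℝ) ^ K)⁻¹ * a) = d * a * (‖ξ.toEucl‖ * ((2 : ℝ) ^ K)⁻¹) := by ring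
      _ ≤ d * a := mul_le_of_le_one_right (by positivity) this
  have h1 := hstep K ξ
  have h2 := hstep K 0
  have h3 := norm_sub_le_norm_sub_add_norm_sub (u ξ) (boxAverage (2 ^ K) u ξ) (u 0)
  have h4 := norm_sub_le_norm_sub_add_norm_sub (boxAverage (2 ^ K) u ξ)
    (boxAverage (2 ^ K) u 0) (u 0)
  rw [norm_sub_rev] at h1
  -- Two chains of `K` scales and one comparison give, in units of `d * a`, at most `6 * (2 * log +
  -- 1) + 1 ≤ 13 * (1 + log)`.
  have h5 : (K : ℝ) * (3 * d * a) ≤ (2 * Real.log ‖ξ.toEucl‖ + 1) * (3 * d * a) := by gcongr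
  have h6 : 0 ≤ d * a * Real.log ‖ξ.toEucl‖ := by positivity
  have h7 : 0 ≤ d * a := by positivity
  linarith

end Averages

/-! ### The discrete Sobolev inequality. -/

section DiscreteSobolev

theorem enorm_le_tsum_enorm_sub {F : ℤ → ℝ} (hF : (Function.support F).Finite) (x : ℤ) :
    ‖F x‖ₑ ≤ ∑' k : ℤ, ‖F (k + 1) - F k‖ₑ := by
  have hinj : Function.Injective fun j : ℕ => x + (j : ℤ) := fun j j' h => by simpa using h
  obtain ⟨n, hn⟩ : ∃ n : ℕ, F (x + n) = 0 := by
    by_contra! hne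
    exact Set.infinite_range_of_injective hinj (hF.subset (Set.range_subset_iff.2 hne))
  have h := Finset.sum_range_sub (fun j : ℕ => F (x + (j : ℤ))) n
  simp only [hn, Nat.cast_zero, add_zero, zero_sub] at h
  rw [← enorm_neg, ← h]
  refine (enorm_sum_le _ _).trans ?_
  have := ENNReal.sum_le_tsum (f := fun k : ℤ => ‖F (k + 1) - F k‖ₑ)
    ((Finset.range n).map ⟨_, hinj⟩)
  rw [Finset.sum_map] at this
  simpa [add_assoc] using this

theorem lintegral_pi_count (f : IntLattice d → ℝ≥0∞) :
    ∫⁻ x, f x ∂(Measure.pi fun _ : Fin d => (Measure.count : Measure ℤ)) = ∑' x, f x := by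
  rw [lintegral_countable']
  refine tsum_congr fun x => ?_
  rw [Measure.pi_singleton]
  simp

/-- The discrete Gagliardo–Nirenberg–Sobolev inequality for `p = 1`. -/
theorem tsum_enorm_rpow_le_of_finite_support (hd : 2 ≤ d) {V : IntLattice d → ℝ}
    (hV : (Function.support V).Finite) :
    ∑' x, ‖V x‖ₑ ^ ((d : ℝ) / (d - 1)) ≤
      (∑ i : Fin d, ∑' x : IntLattice d, ‖V (x + Pi.single i 1) - V x‖ₑ) ^ ((d : ℝ) / (d - 1)) := by
  have hd1 : (1 : ℝ) < d := by exact_mod_cast hd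
  set f : IntLattice d → ℝ≥0∞ := fun x => ∑ i : Fin d, ‖V (x + Pi.single i 1) - V x‖ₑ with hf
  have hconj : Real.HolderConjugate (Fintype.card (Fin d)) ((d : ℝ) / (d - 1)) := by
    rw [Fintype.card_fin]
    exact Real.HolderConjugate.conjExponent hd1
  -- The grid-lines inequality bounds the sum over `x` of a product of line sums of `f`. By
  -- telescoping, each line sum through `x` dominates `‖V x‖ₑ`.
  have key := lintegral_prod_lintegral_pow_le (fun _ : Fin d => (Measure.count : Measure ℤ)) hconj
    (f := f) (measurable_of_countable f)
  rw [lintegral_pi_count, lintegral_pi_count, Fintype.card_fin] at key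
  have hsum : ∑' x, f x = ∑ i : Fin d, ∑' x : IntLattice d, ‖V (x + Pi.single i 1) - V x‖ₑ :=
    Summable.tsum_finsetSum fun _ _ => ENNReal.summable
  rw [← hsum]
  refine le_trans (ENNReal.tsum_le_tsum fun x => ?_) key
  have hpow : ‖V x‖ₑ ^ ((d : ℝ) / (d - 1)) = ∏ _i : Fin d, ‖V x‖ₑ ^ ((1 : ℝ) / (d - 1)) := by
    rw [Finset.prod_const, Finset.card_univ, Fintype.card_fin, ← ENNReal.rpow_natCast,
      ← ENNReal.rpow_mul]
    congr 1
    ring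
  rw [hpow]
  refine Finset.prod_le_prod' fun i _ => ENNReal.rpow_le_rpow ?_ (by
    rw [one_div, inv_nonneg]; linarith)
  rw [lintegral_count]
  have hfin : (Function.support fun k : ℤ => V (Function.update x i k)).Finite :=
    hV.preimage (Function.update_injective x i).injOn
  have h1 := enorm_le_tsum_enorm_sub hfin (x i)
  rw [Function.update_eq_self] at h1
  refine h1.trans (ENNReal.tsum_le_tsum fun k => ?_)
  have hup : Function.update x i (k + 1) = Function.update x i k + Pi.single i 1 := by
    ext j
    by_cases hj : j = i
    · subst hj; simp
    · simp [hj]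
  rw [hup]
  exact Finset.single_le_sum (f := fun j : Fin d =>
    ‖V (Function.update x i k + Pi.single j 1) - V (Function.update x i k)‖ₑ)
    (fun _ _ => zero_le) (Finset.mem_univ i)

/-- A discrete chain rule. For `t ≤ s`, Bernoulli's inequality at `t / s` gives `s ^ γ - t ^ γ ≤ γ *
s ^ (γ - 1) * (s - t)`. -/
theorem abs_rpow_sub_rpow_le {s t γ : ℝ} (hs : 0 ≤ s) (ht : 0 ≤ t) (hγ : 1 ≤ γ) :
    |s ^ γ - t ^ γ| ≤ γ * (s ^ (γ - 1) + t ^ (γ - 1)) * |s - t| := by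
  wlog hst : t ≤ s generalizing s t
  · have := this ht hs (le_of_not_ge hst)
    rwa [abs_sub_comm, add_comm (s ^ (γ - 1)), abs_sub_comm s]
  have hmono : t ^ γ ≤ s ^ γ := Real.rpow_le_rpow ht hst (by linarith)
  rw [abs_of_nonneg (sub_nonneg.2 hmono), abs_of_nonneg (sub_nonneg.2 hst)]
  rcases hs.eq_or_lt with rfl | hs'
  · have : t = 0 := le_antisymm hst ht
    subst this
    simp
  have h1 := one_add_mul_self_le_rpow_one_add (s := t / s - 1)
    (by have : 0 ≤ t / s := by positivity
        linarith) hγ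
  rw [add_sub_cancel, Real.div_rpow ht hs, le_div_iff₀ (by positivity)] at h1
  have h2 : s ^ γ = s ^ (γ - 1) * s := by
    rw [← Real.rpow_add_one hs'.ne']; congr 1; ring
  have h3 : (1 + γ * (t / s - 1)) * s ^ γ = s ^ γ - γ * s ^ (γ - 1) * (s - t) := by
    rw [h2]; field_simp; ring
  have h4 : 0 ≤ γ * t ^ (γ - 1) * (s - t) :=
    mul_nonneg (by positivity) (sub_nonneg.2 hst)
  nlinarith

theorem enorm_rpow_sub_rpow_le {s t γ : ℝ} (hs : 0 ≤ s) (ht : 0 ≤ t) (hγ : 1 ≤ γ) :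
    ‖s ^ γ - t ^ γ‖ₑ ≤
      ENNReal.ofReal γ * (‖s‖ₑ ^ (γ - 1) + ‖t‖ₑ ^ (γ - 1)) * ‖s - t‖ₑ := by
  have hγ' : 0 ≤ γ - 1 := by linarith
  rw [Real.enorm_of_nonneg hs, Real.enorm_of_nonneg ht, ENNReal.ofReal_rpow_of_nonneg hs hγ',
    ENNReal.ofReal_rpow_of_nonneg ht hγ', Real.enorm_eq_ofReal_abs, Real.enorm_eq_ofReal_abs,
    ← ENNReal.ofReal_add (by positivity) (by positivity), ← ENNReal.ofReal_mul (by linarith),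
    ← ENNReal.ofReal_mul (by positivity)]
  exact ENNReal.ofReal_le_ofReal (abs_rpow_sub_rpow_le hs ht hγ)

/-- Hölder's inequality for sums, with a power of the first factor; for `p = 1` the first factor
is trivial. -/
theorem tsum_rpow_mul_le {α : Type*} (h g : α → ℝ≥0∞) {p q θ : ℝ} (hp : 1 ≤ p)
    (hθ : θ * p = q * (p - 1)) :
    ∑' x, h x ^ θ * g x ≤ (∑' x, h x ^ q) ^ (1 - 1 / p) * (∑' x, g x ^ p) ^ (1 / p) := by
  rcases hp.eq_or_lt with rfl | hp1
  · have : θ = 0 := by simpa using hθ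
    simp [this]
  · let _ : MeasurableSpace α := ⊤
    have hconj : Real.HolderConjugate (p / (p - 1)) p :=
      (Real.HolderConjugate.conjExponent hp1).symm
    have key := ENNReal.lintegral_mul_le_Lp_mul_Lq (Measure.count : Measure α) hconj
      (f := fun x => h x ^ θ) (g := g) measurable_from_top.aemeasurable
      measurable_from_top.aemeasurable
    have hp2 : p - 1 ≠ 0 := by linarith
    have e1 : θ * (p / (p - 1)) = q := by
      rw [← mul_div_assoc, hθ]; field_simp
    have e2 : 1 / (p / (p - 1)) = 1 - 1 / p := by field_simp
    simpa only [lintegral_count, Pi.mul_apply, ← ENNReal.rpow_mul, e1, e2] using key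

/-- The discrete Sobolev inequality for finitely supported functions. -/
theorem tsum_enorm_rpow_sobolev_le {p : ℝ} (hp : 1 ≤ p) (hpd : p < d) {v : IntLattice d → ℝ}
    (hv : ∀ x, 0 ≤ v x) (hfin : (Function.support v).Finite) {A : ℝ≥0∞}
    (hA : ∀ i : Fin d, ∑' x : IntLattice d, ‖v (x + Pi.single i 1) - v x‖ₑ ^ p ≤ A ^ p) :
    ∑' x, ‖v x‖ₑ ^ (d * p / (d - p)) ≤
      (d * (ENNReal.ofReal (p * (d - 1) / (d - p)) * 2 * A)) ^ (d * p / (d - p)) := by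
  have hp0 : 0 < p := by linarith
  have hd1 : (1 : ℝ) < d := by linarith
  have hd2 : 2 ≤ d := by exact_mod_cast hd1
  have hdp : 0 < (d : ℝ) - p := by linarith
  have hdm : 0 < (d : ℝ) - 1 := by linarith
  -- Chosen so that `γ * d / (d - 1) = q` and `(γ - 1) * p = q * (p - 1)`: the case `p = 1` for `v ^
  -- γ` and Hölder then both produce the same sum `S`.
  set γ : ℝ := p * (d - 1) / (d - p) with hγ
  set q : ℝ := d * p / (d - p) with hq
  have hq0 : 0 < q := by positivity
  have hγ1 : 1 ≤ γ := by
    rw [hγ, le_div_iff₀ hdp]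
    nlinarith
  have hθ : (γ - 1) * p = q * (p - 1) := by
    rw [hγ, hq]; field_simp; ring
  set S : ℝ≥0∞ := ∑' x, ‖v x‖ₑ ^ q with hS
  have hStop : S ≠ ⊤ := by
    rw [hS, tsum_eq_sum (s := hfin.toFinset)]
    · exact ENNReal.sum_ne_top.2 fun x _ => ENNReal.rpow_ne_top_of_nonneg hq0.le enorm_ne_top
    · intro x hx
      have : v x = 0 := by simpa using hx
      simp [this, hq0]
  have hV := tsum_enorm_rpow_le_of_finite_support hd2 (V := fun x => v x ^ γ)
    (hfin.subset fun x hx => by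
      intro h0
      exact hx (by simp [h0, show γ ≠ 0 by linarith]))
  have hVS : ∑' x, ‖v x ^ γ‖ₑ ^ ((d : ℝ) / (d - 1)) = S := by
    refine tsum_congr fun x => ?_
    rw [Real.enorm_of_nonneg (Real.rpow_nonneg (hv x) _), Real.enorm_of_nonneg (hv x),
      ← ENNReal.ofReal_rpow_of_nonneg (hv x) (by linarith), ← ENNReal.rpow_mul]
    congr 1
    rw [hγ, hq]; field_simp
  have hdir : ∀ i : Fin d, ∑' x : IntLattice d, ‖v (x + Pi.single i 1) ^ γ - v x ^ γ‖ₑ ≤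
      ENNReal.ofReal γ * 2 * A * S ^ (1 - 1 / p) := by
    intro i
    set g : IntLattice d → ℝ≥0∞ := fun x => ‖v (x + Pi.single i 1) - v x‖ₑ with hg
    have hgA : (∑' x, g x ^ p) ^ (1 / p) ≤ A := by
      rw [one_div, ENNReal.rpow_inv_le_iff hp0]
      exact hA i
    have e1 := tsum_rpow_mul_le (fun x => ‖v (x + Pi.single i 1)‖ₑ) g hp hθ
    have e2 := tsum_rpow_mul_le (fun x => ‖v x‖ₑ) g hp hθ
    have e3 : ∑' x : IntLattice d, ‖v (x + Pi.single i 1)‖ₑ ^ q = S :=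
      (Equiv.addRight (Pi.single i 1 : IntLattice d)).tsum_eq (fun x => ‖v x‖ₑ ^ q)
    rw [e3] at e1
    calc ∑' x : IntLattice d, ‖v (x + Pi.single i 1) ^ γ - v x ^ γ‖ₑ
        ≤ ∑' x : IntLattice d, ENNReal.ofReal γ *
            (‖v (x + Pi.single i 1)‖ₑ ^ (γ - 1) * g x + ‖v x‖ₑ ^ (γ - 1) * g x) := by
          refine ENNReal.tsum_le_tsum fun x => ?_
          rw [← add_mul, ← mul_assoc]
          exact enorm_rpow_sub_rpow_le (hv _) (hv _) hγ1
      _ = ENNReal.ofReal γ * (∑' x, ‖v (x + Pi.single i 1)‖ₑ ^ (γ - 1) * g x +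
            ∑' x, ‖v x‖ₑ ^ (γ - 1) * g x) := by
          rw [ENNReal.tsum_mul_left, ENNReal.tsum_add]
      _ ≤ ENNReal.ofReal γ * (S ^ (1 - 1 / p) * A + S ^ (1 - 1 / p) * A) := by
          gcongr
          · exact e1.trans (by gcongr)
          · exact e2.trans (by gcongr)
      _ = _ := by ring
  set K : ℝ≥0∞ := d * (ENNReal.ofReal γ * 2 * A) with hK
  have hmain : S ≤ (K * S ^ (1 - 1 / p)) ^ ((d : ℝ) / (d - 1)) := by
    rw [hVS] at hV
    refine hV.trans (ENNReal.rpow_le_rpow ?_ (by positivity))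
    refine (Finset.sum_le_sum fun i _ => hdir i).trans_eq ?_
    simp [hK]; ring
  by_cases hS0 : S = 0
  · rw [hS0]; exact zero_le
  have h1 : S ^ (1 - 1 / (d : ℝ)) ≤ K * S ^ (1 - 1 / p) := by
    have := ENNReal.rpow_le_rpow hmain (z := 1 - 1 / (d : ℝ)) (by
      rw [sub_nonneg, div_le_one (by linarith)]; linarith)
    rwa [← ENNReal.rpow_mul, show (d : ℝ) / (d - 1) * (1 - 1 / d) = 1 by field_simp,
      ENNReal.rpow_one] at this
  -- Since `1 / q = 1 / p - 1 / d`, the factor `S ^ (1 - 1 / p)` can be absorbed; finite support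
  -- makes `S` finite, which permits the cancellation.
  have h2 : S ^ (1 - 1 / (d : ℝ)) = S ^ (1 / q) * S ^ (1 - 1 / p) := by
    rw [← ENNReal.rpow_add _ _ hS0 hStop]
    congr 1
    rw [hq]; field_simp; ring
  rw [h2] at h1
  have h3 := (ENNReal.mul_le_mul_iff_left (ENNReal.rpow_pos (pos_of_ne_zero hS0) hStop).ne' ?_).1 h1
  · rwa [one_div, ENNReal.rpow_inv_le_iff hq0] at h3
  · exact ENNReal.rpow_ne_top_of_nonneg (by rw [sub_nonneg, div_le_one hp0]; exact hp) hStop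

variable {E : Type*} [NormedAddCommGroup E]

/-- The discrete Sobolev inequality for functions vanishing at infinity. -/
theorem summable_norm_rpow_of_tendsto_zero {p : ℝ} (hp : 1 ≤ p) (hpd : p < d)
    {w : IntLattice d → E} (hw : Filter.Tendsto w Filter.cofinite (nhds 0)) {A : ℝ≥0∞}
    (hAtop : A ≠ ⊤)
    (hA : ∀ i : Fin d, ∑' x : IntLattice d, ‖w (x + Pi.single i 1) - w x‖ₑ ^ p ≤ A ^ p) :
    Summable fun x => ‖w x‖ ^ (d * p / (d - p)) := by
  have hp0 : 0 < p := by linarith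
  have hdp : 0 < (d : ℝ) - p := by linarith
  set q : ℝ := d * p / (d - p) with hq
  have hq0 : 0 < q := by
    have : (0 : ℝ) < d := by linarith
    positivity
  set B : ℝ≥0∞ := (d * (ENNReal.ofReal (p * (d - 1) / (d - p)) * 2 * A)) ^ q with hB
  have hBtop : B ≠ ⊤ := ENNReal.rpow_ne_top_of_nonneg hq0.le
    (ENNReal.mul_ne_top (by simp) (ENNReal.mul_ne_top (by finiteness) hAtop))
  -- Truncation at height `ε` leaves finite support because `w` tends to `0`, and it does not
  -- increase differences. The bound is free of `ε`, so `ε → 0` is allowed.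
  have htrunc : ∀ ε : ℝ, 0 < ε → ∀ s : Finset (IntLattice d),
      ∑ x ∈ s, max (‖w x‖ - ε) 0 ^ q ≤ B.toReal := by
    intro ε hε s
    set v : IntLattice d → ℝ := fun x => max (‖w x‖ - ε) 0 with hv
    have hv0 : ∀ x, 0 ≤ v x := fun x => le_max_right _ _
    have hfin : (Function.support v).Finite := by
      have := (Metric.tendsto_nhds.1 hw) ε hε
      rw [Filter.eventually_cofinite] at this
      refine this.subset fun x hx hlt => hx ?_
      rw [dist_zero_right] at hlt
      exact max_eq_right (by linarith)
    have h1 := tsum_enorm_rpow_sobolev_le hp hpd hv0 hfin (A := A) fun i =>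
      (ENNReal.tsum_le_tsum fun x => by
        gcongr
        rw [← ofReal_norm, ← ofReal_norm]
        refine ENNReal.ofReal_le_ofReal ?_
        rw [Real.norm_eq_abs]
        refine (abs_max_sub_max_le_abs _ _ _).trans ?_
        rw [sub_sub_sub_cancel_right]
        exact abs_norm_sub_norm_le _ _).trans (hA i)
    have h2 := (ENNReal.sum_le_tsum s).trans h1
    rw [← ENNReal.ofReal_le_iff_le_toReal hBtop, ENNReal.ofReal_sum_of_nonneg fun x _ =>
      Real.rpow_nonneg (hv0 x) _]
    refine le_of_eq_of_le (Finset.sum_congr rfl fun x _ => ?_) h2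
    rw [Real.enorm_of_nonneg (hv0 x), ENNReal.ofReal_rpow_of_nonneg (hv0 x) hq0.le]
  refine summable_of_sum_le (c := B.toReal) (fun x => by positivity) fun s => ?_
  have hcont : Continuous fun ε : ℝ => ∑ x ∈ s, max (‖w x‖ - ε) 0 ^ q := by
    refine continuous_finsetSum _ fun x _ => ?_
    exact Continuous.rpow_const (by fun_prop) fun _ => Or.inr hq0.le
  have hlim := (hcont.tendsto 0).mono_left (nhdsWithin_le_nhds (s := Set.Ioi 0))
  simp only [sub_zero, max_eq_left (norm_nonneg _)] at hlim
  exact le_of_tendsto hlim (eventually_nhdsWithin_of_forall fun ε hε => htrunc ε hε s)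

end DiscreteSobolev

/-! ### Existence of a limit at infinity for `p < d`. -/

section Limit

variable {E : Type*} [NormedAddCommGroup E]

theorem DifferencesBoundedBy.tendsto_sub_single {u : IntLattice d → E} {p a : ℝ}
    (h : DifferencesBoundedBy u p a) (hp : 1 ≤ p) (i : Fin d) :
    Filter.Tendsto (fun y => u (y + Pi.single i 1) - u y) Filter.cofinite (nhds 0) := by
  have hp0 : 0 < p := by linarith
  have h1 : Summable fun y : IntLattice d => ‖u (y + Pi.single i 1) - u y‖ ^ p :=
    summable_of_sum_le (fun _ => by positivity) (h i)
  have h2 := h1.tendsto_cofinite_zero.rpow_const (p := 1 / p) (Or.inr (by positivity))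
  rw [Real.zero_rpow (by positivity)] at h2
  refine tendsto_zero_iff_norm_tendsto_zero.2 (h2.congr fun y => ?_)
  rw [← Real.rpow_mul (norm_nonneg _), mul_one_div_cancel hp0.ne', Real.rpow_one]

theorem DifferencesBoundedBy.tendsto_sub_of_mem_latticeBox {u : IntLattice d → E} {p a : ℝ}
    (h : DifferencesBoundedBy u p a) (hp : 1 ≤ p) {n : ℕ} {z : IntLattice d}
    (hz : z ∈ latticeBox d n) :
    Filter.Tendsto (fun y => u (y + z) - u y) Filter.cofinite (nhds 0) := by
  set P : IntLattice d → Prop := fun z =>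
    Filter.Tendsto (fun y => u (y + z) - u y) Filter.cofinite (nhds 0) with hP
  have hadd : ∀ z z', P z → P z' → P (z + z') := by
    intro z z' h1 h2
    have h3 := (h2.comp (add_left_injective z).tendsto_cofinite).add h1
    rw [add_zero] at h3
    refine h3.congr fun y => ?_
    simp [add_assoc]
  have hzero : P 0 := by simpa [hP] using tendsto_const_nhds
  have hsingle : ∀ (i : Fin d) (k : ℕ), P (Pi.single i (k : ℤ)) := by
    intro i k
    induction k with
    | zero => simpa using hzero
    | succ k ih =>
      rw [Nat.cast_succ, Pi.single_add]
      exact hadd _ _ ih (h.tendsto_sub_single hp i)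
  have hsum : P (∑ i, Pi.single i (z i)) := by
    refine Finset.sum_induction _ P hadd hzero fun i _ => ?_
    have hz0 : 0 ≤ z i := (Finset.mem_Ico.1 ((Fintype.mem_piFinset.1 hz) i)).1
    have := hsingle i (z i).toNat
    rwa [Int.toNat_of_nonneg hz0] at this
  rwa [Finset.univ_sum_single] at hsum

/-- Below the critical exponent, functions with `ℓ^p` differences converge at infinity. -/
theorem DifferencesBoundedBy.exists_tendsto_cofinite [NormedSpace ℝ E] [CompleteSpace E] {u : IntLattice d → E}
    {p a : ℝ} (h : DifferencesBoundedBy u p a) (hp : 1 ≤ p) (hpd : p < d) (ha : 0 ≤ a) :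
    ∃ t : E, Filter.Tendsto u Filter.cofinite (nhds t) := by
  have hp0 : 0 < p := by linarith
  have hd0 : d ≠ 0 := by rintro rfl; norm_num at hpd; linarith
  set r : ℝ := (2 : ℝ) ^ (1 - d / p) with hr
  set C : ℝ := 3 * d * a with hC
  have hr1 : r < 1 := by
    refine Real.rpow_lt_one_of_one_lt_of_neg (by norm_num) ?_
    rw [sub_neg, one_lt_div hp0]; exact hpd
  have hr0 : 0 < r := by positivity
  have hgeo : ∀ (y : IntLattice d) (k : ℕ),
      dist (boxAverage (2 ^ k) u y) (boxAverage (2 ^ (k + 1)) u y) ≤ C * r ^ k := by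
    intro y k
    rw [dist_comm, dist_eq_norm]
    exact h.norm_boxAverage_two_pow_succ_sub_le hp ha k y
  choose t ht using fun y => cauchySeq_tendsto_of_complete
    (cauchySeq_of_le_geometric r C hr1 (hgeo y))
  -- At scale `2 ^ k`, moving the base point to `y` changes the average by a multiple of `2 ^ (-(k *
  -- d / p))`, so all base points share one limit.
  have ht0 : ∀ y, t y = t 0 := by
    intro y
    rw [← sub_eq_zero]
    refine tendsto_nhds_unique ((ht y).sub (ht 0)) ?_
    refine squeeze_zero_norm (a := fun k : ℕ => d * ‖y.toEucl‖ * ((((2 ^ k : ℕ) : ℝ) ^ d) ^ (-(1 / p)) * a))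
      (fun k => by
      have := h.norm_boxAverage_add_sub_le hp ha (n := 2 ^ k) (by positivity) 0 y
        (natAbs_le_norm_toEucl y)
      rwa [zero_add] at this) ?_
    have h1 : Filter.Tendsto (fun k : ℕ => ((2 ^ k : ℕ) : ℝ) ^ d) Filter.atTop Filter.atTop := by
      refine (Filter.tendsto_pow_atTop hd0).comp ?_
      exact tendsto_natCast_atTop_atTop.comp (tendsto_pow_atTop_atTop_of_one_lt one_lt_two)
    have h2 := (((tendsto_rpow_neg_atTop (y := 1 / p) (by positivity)).comp h1).mul_const
      a).const_mul (d * ‖y.toEucl‖)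
    simpa using h2
  have hclose : ∀ (y : IntLattice d) (k : ℕ),
      dist (boxAverage (2 ^ k) u y) (t 0) ≤ C * r ^ k / (1 - r) := fun y k =>
    dist_le_of_le_geometric_of_tendsto r C hr1 (hgeo y) (ht0 y ▸ ht y) k
  refine ⟨t 0, Metric.tendsto_nhds.2 fun ε hε => ?_⟩
  -- `hclose` is uniform in `y`, so one scale `k` serves all points; off a finite set, `u` hardly
  -- varies over a box of that fixed size.
  obtain ⟨k, hk⟩ : ∃ k : ℕ, C * r ^ k / (1 - r) < ε / 2 := by
    have h1 := ((tendsto_pow_atTop_nhds_zero_of_lt_one hr0.le hr1).const_mul C).div_const (1 - r)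
    rw [mul_zero, zero_div] at h1
    exact (h1.eventually (gt_mem_nhds (half_pos hε))).exists
  have hbox : ∀ᶠ y in Filter.cofinite, ∀ z ∈ latticeBox d (2 ^ k), ‖u (y + z) - u y‖ ≤ ε / 2 := by
    rw [Filter.eventually_all_finset]
    intro z hz
    have h1 := Metric.tendsto_nhds.1 (h.tendsto_sub_of_mem_latticeBox hp hz) (ε / 2) (half_pos hε)
    filter_upwards [h1] with y hy
    rw [dist_zero_right] at hy
    exact hy.le
  filter_upwards [hbox] with y hy
  have h1 := norm_boxAverage_sub_le (by positivity) hy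
  have h2 := dist_triangle_left (u y) (t 0) (boxAverage (2 ^ k) u y)
  rw [dist_eq_norm (boxAverage (2 ^ k) u y) (u y)] at h2
  linarith [hclose y k]

end Limit

end LatticeInterpolation

/-! ### The three regimes. -/

theorem mainTheorem7 (d m : ℕ) (ζ : Eucl d → ℝ) (hζ : IsNodalBasis ζ) (p : ℝ) (hp : 1 ≤ p) :
    ((d : ℝ) < p → ∃ C : ℝ, ∀ u : LatticeFun d m,
      translationClass u ∈ homogeneousSpace ζ m (ENNReal.ofReal p) →
      ∀ ξ : IntLattice d, ‖u ξ - u 0‖ ≤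
        C * (latticeSeminorm ζ (ENNReal.ofReal p) u).toReal *
          ‖ξ.toEucl‖ ^ (1 / Real.conjExponent p)) ∧
    (p = d → ∃ C : ℝ, ∀ u : LatticeFun d m,
      translationClass u ∈ homogeneousSpace ζ m (ENNReal.ofReal p) →
      ∀ ξ : IntLattice d, ξ ≠ 0 → ‖u ξ - u 0‖ ≤
        C * (latticeSeminorm ζ (ENNReal.ofReal p) u).toReal * (1 + Real.log ‖ξ.toEucl‖)) ∧
    (p < d → ∀ u : LatticeFun d m,
      translationClass u ∈ homogeneousSpace ζ m (ENNReal.ofReal p) →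
      ∃ u₀ ∈ translationClass u,
        Memℓp (E := fun _ : IntLattice d => Eucl m) u₀ (ENNReal.ofReal (d * p / (d - p)))) := by
  have hp0 : 0 < p := by linarith
  obtain ⟨C, hC0, hC⟩ := hζ.exists_tsum_enorm_sub_rpow_le_latticeSeminorm m hp
  have hbound : ∀ u : LatticeFun d m,
      translationClass u ∈ homogeneousSpace ζ m (ENNReal.ofReal p) →
      DifferencesBoundedBy u p (C * (latticeSeminorm ζ (ENNReal.ofReal p) u).toReal) :=
    fun u hu => differencesBoundedBy_of_tsum_le hp0.le (by positivity) (hC u hu)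
  refine ⟨fun _ => ⟨d * C, fun u hu ξ => ?_⟩, fun hpd => ⟨13 * d * C, fun u hu ξ hξ => ?_⟩,
    fun hpd u hu => ?_⟩
  · have h := (hbound u hu).norm_sub_le_rpow hp (by positivity) ξ
    have he : 1 / Real.conjExponent p = 1 - 1 / p := by
      rw [Real.conjExponent, one_div_div, sub_div, div_self hp0.ne']
    rw [he, mul_assoc (d : ℝ)]
    exact h
  · subst hpd
    have h := (hbound u hu).norm_sub_le_log (by exact_mod_cast hp) (by positivity) hξ
    rw [mul_assoc (13 * (d : ℝ))]
    exact h
  · obtain ⟨t, ht⟩ := (hbound u hu).exists_tendsto_cofinite hp hpd (by positivity)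
    refine ⟨fun ξ => u ξ + -t, ⟨-t, rfl⟩, ?_⟩
    have hdp : 0 < (d : ℝ) - p := by linarith
    have hq : 0 < d * p / ((d : ℝ) - p) := by
      have : (0 : ℝ) < d := by linarith
      positivity
    have hw : Filter.Tendsto (fun ξ => u ξ + -t) Filter.cofinite (nhds 0) := by
      simpa using ht.add_const (-t)
    refine memℓp_gen ?_
    rw [ENNReal.toReal_ofReal hq.le]
    refine summable_norm_rpow_of_tendsto_zero hp hpd hw
      (A := ENNReal.ofReal (C * (latticeSeminorm ζ (ENNReal.ofReal p) u).toReal))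
      ENNReal.ofReal_ne_top fun i => ?_
    simpa only [add_sub_add_right_eq_sub] using hC u hu i
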